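/- **Definitions.** Let $G\le \mathrm{Sym}(\Omega)$ be a permutation group on a finite nonempty set $\Omega$. The index $\mathrm{ind}(\sigma)$ of $\sigma\in \mathrm{Sym}(\Omega)$ is $|\Omega|$ minus the number of disjoint cycles of $\sigma$ (fixed points counted as cycles), and the generator index of $G$ is $$gi(G)=\min_{S\subseteq G,\ \langle S\rangle=G}\ \max_{\sigma\in S}\mathrm{ind}(\sigma)$$ (the maximum over $S=\emptyset$ being $0$). A finite extension $F/\mathbb{Q}$ is called a $G$-extension if the Galois group of its Galois closure $N/\mathbb{Q}$, acting on the $[F:\mathbb{Q}]$ embeddings $F\to N$, is permutation-isomorphic to $G$. An integer is $k$-free if it is not divisible by $p^k$ for any prime $p$. For a transitive group $G$, say that $Q(G)$ holds if for every positive integer $N$ there is a $G$-extension $F/\mathbb{Q}$ (of degree equal to the degree of $G$) whose discriminant is $(gi(G)+1)$-free and coprime to $N$. **Lemma.** Let $G\le \mathrm{Sym}(\Omega)$ and $H\le \mathrm{Sym}(\Omega')$ be transitive permutation groups on finite nonempty sets, of degrees $m=|\Omega|$ and $n=|\Omega'|$. Then $G\times H$, acting on $\Omega\times\Omega'$ by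 $(g,h)(a,b)=(g(a),h(b))$, is a transitive group of degree $mn$, with $$gi(G\times H)=\max\{n\cdot gi(G),\ m\cdot gi(H)\},$$ and if $Q(G)$ and $Q(H)$ hold, then $Q(G\times H)$ holds. In particular, $Q(A)$ holds for every abelian transitive permutation group $A$ on a finite nonempty set. -/

import Mathlib

/-- The index of a permutation `σ` of a finite set: the number of points minus the number of
disjoint cycles of `σ`. Fixed points count as cycles of length one, so that the cycles are the
classes of the relation "in the same cycle"; the subtraction never truncates. -/
noncomputable def permIndex {α : Type*} (σ : Equiv.Perm α) : ℕ :=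
  Nat.card α - Nat.card (Quotient (Equiv.Perm.SameCycle.setoid σ))

/-- The generator index of a permutation group `G` on a finite set: the minimum over all generating
sets `S` of `G` of the maximal index of an element of `S` (which is `0` for `S = ∅`).
All subsets of `G` are finite here, since the underlying set is finite. -/
noncomputable def generatorIndex {α : Type*} (G : Subgroup (Equiv.Perm α)) : ℕ :=
  sInf {k : ℕ | ∃ S : Finset (Equiv.Perm α),
    Subgroup.closure (S : Set (Equiv.Perm α)) = G ∧ S.sup permIndex = k}

/-- The homomorphism `Perm α × Perm β → Perm (α × β)` given by the coordinatewise action. -/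
def permProdHom (α β : Type*) :
    Equiv.Perm α × Equiv.Perm β →* Equiv.Perm (α × β) where
  toFun x := Equiv.prodCongr x.1 x.2
  map_one' := by ext <;> rfl
  map_mul' _ _ := by ext <;> rfl

/-- The direct product `G × H` as a permutation group on `α × β`. -/
def productAction {α β : Type*} (G : Subgroup (Equiv.Perm α)) (H : Subgroup (Equiv.Perm β)) :
    Subgroup (Equiv.Perm (α × β)) :=
  (G.prod H).map (permProdHom α β)

/-- A finite separable extension `F / K` is a `G`-extension if the Galois group of its Galois
closure `N`, acting on the `K`-embeddings of `F` into `N`, is permutation-isomorphic to `G`. -/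
structure IsGExtension (K F : Type*) [Field K] [Field F] [Algebra K F]
    {α : Type*} (G : Subgroup (Equiv.Perm α)) : Prop where
  finiteDimensional : FiniteDimensional K F
  isSeparable : Algebra.IsSeparable K F
  exists_permIso :
    ∃ (φ : G ≃* (IntermediateField.normalClosure K F (AlgebraicClosure K) ≃ₐ[K]
          IntermediateField.normalClosure K F (AlgebraicClosure K)))
      (e : α ≃ (F →ₐ[K] IntermediateField.normalClosure K F (AlgebraicClosure K))),
      ∀ (g : G) (a : α), e ((g : Equiv.Perm α) a) = (φ g).toAlgHom.comp (e a)

/-- An integer is `k`-free if it is not divisible by the `k`-th power of any prime number. -/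
def IsPowerFree (k : ℕ) (d : ℤ) : Prop :=
  ∀ p : ℕ, p.Prime → ¬ ((p : ℤ) ^ k ∣ d)

/-- For every positive integer `N` there is a `G`-extension `F / ℚ` whose discriminant is
`(e + 1)`-free and coprime to `N`, where `e` is the generator index of `G`. The degree of `F` is
the number of its embeddings, hence the degree of `G`. -/
def StrongQuestion {α : Type*} (G : Subgroup (Equiv.Perm α)) : Prop :=
  ∀ N : ℕ, 0 < N → ∃ (F : Type) (_ : Field F) (_ : NumberField F),
    IsGExtension ℚ F G ∧
    IsPowerFree (generatorIndex G + 1) (NumberField.discr F) ∧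
    IsCoprime (NumberField.discr F) (N : ℤ)

/-! Generator index: a cycle of `σ × τ` projects onto a cycle of `σ`, so `ind(σ × τ) ≥ n · ind(σ)`,
with equality when `τ = 1`. Projecting generators of `G × H` to each factor gives the lower bound;
the union of optimal generating sets of `G × 1` and `1 × H` attains it.

Fields: take a `G`-extension `F₁` and an `H`-extension `F₂` with coprime discriminants. A prime not
dividing `discr F` is unramified in the Galois closure, so the two Galois closures have coprime
discriminants as well. By Minkowski they intersect in `ℚ`, and their automorphisms can be prescribed
independently. Hence the embeddings of the compositum are the pairs of embeddings, permuted by `G ×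
H`, and its discriminant is `d₁ ^ n * d₂ ^ m` up to sign. These exponents match the formula for the
generator index, and each prime divides at most one factor.

Abelian groups: a transitive abelian group is regular, and it is a product of cyclic groups of prime
power order. For a cyclic group of prime power order `n`, every generating set contains an
`n`-cycle, so the generator index is at least `n - 1`. A subfield of a cyclotomic field of prime
conductor `ℓ ≡ 1 mod n` then suffices, because it is ramified at most at `ℓ`, and tamely. -/

section

open Equiv

/-! ### Index of a product permutation -/

section PermIndex

variable {α β : Type*}

theorem permIndex_permCongr (e : α ≃ β) (σ : Perm α) :
    permIndex (e.permCongr σ) = permIndex σ := by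
  have key : ∀ x y : α, σ.SameCycle x y ↔ (e.permCongr σ).SameCycle (e x) (e y) := by
    intro x y
    refine exists_congr fun i => ?_
    have : (e.permCongr σ) ^ i = e.permCongr (σ ^ i) :=
      (map_zpow (e.permCongrHom : Perm α ≃* Perm β) σ i).symm
    rw [this]
    simp
  unfold permIndex
  rw [Nat.card_congr e, Nat.card_congr (Quotient.congr (ra := Perm.SameCycle.setoid σ)
    (rb := Perm.SameCycle.setoid (e.permCongr σ)) e key)]

theorem prodCongr_zpow (σ : Perm α) (τ : Perm β) (i : ℤ) :
    (prodCongr σ τ : Perm (α × β)) ^ i = prodCongr (σ ^ i) (τ ^ i) :=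
  (map_zpow (permProdHom α β) (σ, τ) i).symm

theorem permIndex_prodCongr_comm (σ : Perm α) (τ : Perm β) :
    permIndex (prodCongr τ σ : Perm (β × α)) = permIndex (prodCongr σ τ : Perm (α × β)) := by
  rw [← permIndex_permCongr (prodComm α β) (prodCongr σ τ)]
  congr 1

variable [Finite α] [Finite β]

/-- Every cycle of `σ × τ` meets `{a} × β` for `a` the chosen representative of some cycle of `σ`.
So there are at most `|β|` times as many cycles as for `σ`. -/
theorem card_mul_permIndex_le_permIndex_prodCongr (σ : Perm α) (τ : Perm β) :
    Nat.card β * permIndex σ ≤ permIndex (prodCongr σ τ : Perm (α × β)) := by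
  have h : Nat.card (Quotient (Perm.SameCycle.setoid (prodCongr σ τ : Perm (α × β)))) ≤
      Nat.card β * Nat.card (Quotient (Perm.SameCycle.setoid σ)) := by
    rw [← Nat.card_prod]
    refine Nat.card_le_card_of_surjective
      (fun x : β × Quotient (Perm.SameCycle.setoid σ) => Quotient.mk _ (x.2.out, x.1)) ?_
    intro q
    induction q using Quotient.inductionOn with
    | _ x =>
      obtain ⟨a, b⟩ := x
      obtain ⟨i, hi⟩ : σ.SameCycle
          (Quotient.mk (Perm.SameCycle.setoid σ) a).out a := Quotient.mk_out (s := Perm.SameCycle.setoid σ) a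
      -- The power `i` carries the representative to `a`, so the second coordinate is pulled back by
      -- `τ ^ i` to land on `b`.
      refine ⟨((τ ^ i)⁻¹ b, Quotient.mk _ a), Quotient.sound ⟨i, ?_⟩⟩
      rw [prodCongr_zpow]
      simp [hi]
  unfold permIndex
  rw [Nat.card_prod, Nat.mul_sub, mul_comm (Nat.card α)]
  omega

theorem permIndex_prodCongr_one_right (σ : Perm α) :
    permIndex (prodCongr σ 1 : Perm (α × β)) = Nat.card β * permIndex σ := by
  refine le_antisymm ?_ (card_mul_permIndex_le_permIndex_prodCongr σ 1)
  have h : Nat.card β * Nat.card (Quotient (Perm.SameCycle.setoid σ)) ≤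
      Nat.card (Quotient (Perm.SameCycle.setoid (prodCongr σ 1 : Perm (α × β)))) := by
    rw [← Nat.card_prod]
    refine Nat.card_le_card_of_surjective
      (Quotient.lift (fun x : α × β => (x.2, Quotient.mk (Perm.SameCycle.setoid σ) x.1)) ?_) ?_
    · rintro ⟨a, b⟩ ⟨a', b'⟩ ⟨i, hi⟩
      rw [prodCongr_zpow] at hi
      simp only [one_zpow, prodCongr_apply, Prod.map_apply, Perm.coe_one, id_eq,
        Prod.mk.injEq] at hi
      exact Prod.ext hi.2 (Quotient.sound ⟨i, hi.1⟩)
    · rintro ⟨b, q⟩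
      induction q using Quotient.inductionOn with
      | _ a => exact ⟨Quotient.mk _ (a, b), rfl⟩
  unfold permIndex
  rw [Nat.card_prod, Nat.mul_sub, mul_comm (Nat.card α)]
  omega

end PermIndex

/-! ### Generator index of a product action -/

section GeneratorIndex

variable {α β : Type*}

theorem generatorIndex_le {G : Subgroup (Perm α)} {S : Finset (Perm α)}
    (hS : Subgroup.closure (S : Set (Perm α)) = G) : generatorIndex G ≤ S.sup permIndex :=
  Nat.sInf_le ⟨S, hS, rfl⟩

theorem exists_finset_closure_eq_sup_eq_generatorIndex [Finite α] (G : Subgroup (Perm α)) :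
    ∃ S : Finset (Perm α), Subgroup.closure (S : Set (Perm α)) = G ∧
      S.sup permIndex = generatorIndex G := by
  refine Nat.sInf_mem (s := {k : ℕ | ∃ S : Finset (Perm α),
    Subgroup.closure (S : Set (Perm α)) = G ∧ S.sup permIndex = k}) ?_
  exact ⟨_, (Set.toFinite (G : Set (Perm α))).toFinset, by simp, rfl⟩

theorem generatorIndex_map_permCongr_le [Finite α] (e : α ≃ β) (G : Subgroup (Perm α)) :
    generatorIndex (G.map (e.permCongrHom : Perm α →* Perm β)) ≤ generatorIndex G := by
  classical
  obtain ⟨S, hS, hS'⟩ := exists_finset_closure_eq_sup_eq_generatorIndex G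
  rw [← hS']
  refine (generatorIndex_le (S := S.image e.permCongr) ?_).trans ?_
  · rw [← hS, MonoidHom.map_closure, Finset.coe_image]
    rfl
  · rw [Finset.sup_image]
    exact Finset.sup_mono_fun fun σ _ => (permIndex_permCongr e σ).le

theorem map_permCongrHom_symm_map (e : α ≃ β) (G : Subgroup (Perm α)) :
    (G.map (e.permCongrHom : Perm α →* Perm β)).map (e.symm.permCongrHom : Perm β →* Perm α) =
      G := by
  rw [Subgroup.map_map]
  convert! Subgroup.map_id G using 1
  congr 1
  ext σ x
  simp

theorem generatorIndex_map_permCongr [Finite α] (e : α ≃ β) (G : Subgroup (Perm α)) :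
    generatorIndex (G.map (e.permCongrHom : Perm α →* Perm β)) = generatorIndex G := by
  have := Finite.of_equiv α e
  refine le_antisymm (generatorIndex_map_permCongr_le e G) ?_
  conv_lhs => rw [← map_permCongrHom_symm_map e G]
  exact generatorIndex_map_permCongr_le e.symm _

theorem permProdHom_injective (α β : Type*) [Nonempty α] [Nonempty β] :
    Function.Injective (permProdHom α β) := by
  rintro ⟨g, h⟩ ⟨g', h'⟩ hgh
  have key : ∀ (a : α) (b : β), (g a, h b) = (g' a, h' b) := fun a b => Equiv.congr_fun hgh (a, b)
  obtain ⟨a₀⟩ := ‹Nonempty α›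
  obtain ⟨b₀⟩ := ‹Nonempty β›
  refine Prod.ext (Equiv.ext fun a => ?_) (Equiv.ext fun b => ?_)
  · exact congrArg Prod.fst (key a b₀)
  · exact congrArg Prod.snd (key a₀ b)

theorem mem_productAction {G : Subgroup (Perm α)} {H : Subgroup (Perm β)} {σ : Perm (α × β)} :
    σ ∈ productAction G H ↔ ∃ g ∈ G, ∃ h ∈ H, prodCongr g h = σ := by
  constructor
  · rintro ⟨⟨g, h⟩, hx, rfl⟩
    exact ⟨g, hx.1, h, hx.2, rfl⟩
  · rintro ⟨g, hg, h, hh, rfl⟩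
    exact ⟨(g, h), ⟨hg, hh⟩, rfl⟩

theorem map_prodComm_productAction (G : Subgroup (Perm α)) (H : Subgroup (Perm β)) :
    (productAction G H).map ((prodComm α β).permCongrHom : Perm (α × β) →* Perm (β × α)) =
      productAction H G := by
  ext σ
  simp only [Subgroup.mem_map, mem_productAction]
  constructor
  · rintro ⟨_, ⟨g, hg, h, hh, rfl⟩, rfl⟩
    exact ⟨h, hh, g, hg, rfl⟩
  · rintro ⟨h, hh, g, hg, rfl⟩
    exact ⟨_, ⟨g, hg, h, hh, rfl⟩, rfl⟩

theorem isPretransitive_productAction {G : Subgroup (Perm α)} {H : Subgroup (Perm β)}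
    (hG : MulAction.IsPretransitive G α) (hH : MulAction.IsPretransitive H β) :
    MulAction.IsPretransitive (productAction G H) (α × β) := by
  refine ⟨fun ⟨a, b⟩ ⟨a', b'⟩ => ?_⟩
  obtain ⟨g, rfl⟩ := hG.exists_smul_eq a a'
  obtain ⟨h, rfl⟩ := hH.exists_smul_eq b b'
  exact ⟨⟨prodCongr g.1 h.1, mem_productAction.2 ⟨_, g.2, _, h.2, rfl⟩⟩, rfl⟩

/-- The first coordinates of a generating set of `G × H` generate `G`, and passing to `σ × τ`
multiplies the index of `σ` by at least `|β|`. -/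
theorem card_mul_generatorIndex_le [Finite α] [Nonempty α] [Finite β] [Nonempty β]
    (G : Subgroup (Perm α)) (H : Subgroup (Perm β)) :
    Nat.card β * generatorIndex G ≤ generatorIndex (productAction G H) := by
  obtain ⟨S, hS, hS'⟩ := exists_finset_closure_eq_sup_eq_generatorIndex (productAction G H)
  set S₀ : Set (Perm α × Perm β) := permProdHom α β ⁻¹' S with hS₀
  have himg : permProdHom α β '' S₀ = S := by
    refine Set.image_preimage_eq_of_subset fun σ hσ => ?_
    have : σ ∈ productAction G H := hS ▸ Subgroup.subset_closure hσ
    obtain ⟨x, -, hx⟩ := this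
    exact ⟨x, hx⟩
  have hcl : Subgroup.closure S₀ = G.prod H := by
    apply Subgroup.map_injective (permProdHom_injective α β)
    rw [MonoidHom.map_closure, himg, hS]
    rfl
  have hT : Subgroup.closure
      (((Set.toFinite (Prod.fst '' S₀)).toFinset : Finset (Perm α)) : Set (Perm α)) = G := by
    have := MonoidHom.map_closure (MonoidHom.fst (Perm α) (Perm β)) S₀
    rw [hcl] at this
    rw [Set.Finite.coe_toFinset]
    refine this.symm.trans (le_antisymm ?_ ?_)
    · rintro _ ⟨x, hx, rfl⟩
      exact hx.1
    · exact fun g hg => ⟨(g, 1), ⟨hg, one_mem _⟩, rfl⟩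
  refine (Nat.mul_le_mul_left _ (generatorIndex_le hT)).trans ?_
  -- Moving the factor `|β|` to the right as a division leaves a bare supremum, which can be bounded
  -- one element at a time.
  rw [mul_comm, ← Nat.le_div_iff_mul_le Nat.card_pos, ← hS', Finset.sup_le_iff]
  intro σ hσ
  obtain ⟨⟨g, h⟩, hgh, rfl⟩ := (Set.Finite.mem_toFinset _).1 hσ
  rw [Nat.le_div_iff_mul_le Nat.card_pos, mul_comm]
  exact (card_mul_permIndex_le_permIndex_prodCongr g h).trans
    (Finset.le_sup (f := permIndex) (by exact hgh))

theorem generatorIndex_productAction_le [Finite α] [Finite β]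
    (G : Subgroup (Perm α)) (H : Subgroup (Perm β)) :
    generatorIndex (productAction G H) ≤
      max (Nat.card β * generatorIndex G) (Nat.card α * generatorIndex H) := by
  classical
  obtain ⟨S, hS, hS'⟩ := exists_finset_closure_eq_sup_eq_generatorIndex G
  obtain ⟨T, hT, hT'⟩ := exists_finset_closure_eq_sup_eq_generatorIndex H
  let i : Perm α →* Perm (α × β) := (permProdHom α β).comp (MonoidHom.inl _ _)
  let j : Perm β →* Perm (α × β) := (permProdHom α β).comp (MonoidHom.inr _ _)
  have hcl : Subgroup.closure ((S.image i ∪ T.image j : Finset (Perm (α × β))) : Set _) =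
      productAction G H := by
    rw [Finset.coe_union, Subgroup.closure_union, Finset.coe_image, Finset.coe_image,
      ← MonoidHom.map_closure, ← MonoidHom.map_closure, hS, hT]
    refine le_antisymm (sup_le ?_ ?_) ?_
    · rintro _ ⟨g, hg, rfl⟩
      exact ⟨(g, 1), ⟨hg, one_mem _⟩, rfl⟩
    · rintro _ ⟨h, hh, rfl⟩
      exact ⟨(1, h), ⟨one_mem _, hh⟩, rfl⟩
    · rintro _ ⟨⟨g, h⟩, ⟨hg, hh⟩, rfl⟩
      have : permProdHom α β (g, h) = i g * j h := by
        simp [i, j, ← map_mul]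
      rw [this]
      exact Subgroup.mul_mem_sup ⟨g, hg, rfl⟩ ⟨h, hh, rfl⟩
  refine (generatorIndex_le hcl).trans (Finset.sup_le fun σ hσ => ?_)
  rcases Finset.mem_union.1 hσ with hσ | hσ
  · obtain ⟨g, hg, rfl⟩ := Finset.mem_image.1 hσ
    refine le_max_of_le_left ?_
    rw [← hS']
    exact (permIndex_prodCongr_one_right g).le.trans
      (Nat.mul_le_mul_left _ (Finset.le_sup (f := permIndex) hg))
  · obtain ⟨h, hh, rfl⟩ := Finset.mem_image.1 hσ
    refine le_max_of_le_right ?_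
    rw [← hT']
    exact ((permIndex_prodCongr_comm h 1).trans (permIndex_prodCongr_one_right h)).le.trans
      (Nat.mul_le_mul_left _ (Finset.le_sup (f := permIndex) hh))

theorem generatorIndex_productAction [Finite α] [Nonempty α] [Finite β] [Nonempty β]
    (G : Subgroup (Perm α)) (H : Subgroup (Perm β)) :
    generatorIndex (productAction G H) =
      max (Nat.card β * generatorIndex G) (Nat.card α * generatorIndex H) := by
  refine le_antisymm (generatorIndex_productAction_le G H)
    (max_le (card_mul_generatorIndex_le G H) ?_)
  rw [← generatorIndex_map_permCongr (prodComm α β), map_prodComm_productAction]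
  exact card_mul_generatorIndex_le H G

end GeneratorIndex

end

section

open IntermediateField

/-! ### `G`-extensions through embeddings into an algebraic closure -/

section GExtension

variable {K F : Type*} [Field K] [Field F] [Algebra K F] {α : Type*} {G : Subgroup (Equiv.Perm α)}

theorem restrictNormal_comp_algHomEquiv_symm {E : Type*} [Field E] [Algebra K E] [Normal K E]
    (γ : E ≃ₐ[K] E) (f : F →ₐ[K] normalClosure K F E) :
    normalClosure.algHomEquiv K F E ((γ.restrictNormal (normalClosure K F E)).toAlgHom.comp f) =
      γ.toAlgHom.comp (normalClosure.algHomEquiv K F E f) := by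
  ext x
  exact γ.restrictNormal_commutes (normalClosure K F E) (f x)

/-- In a `G`-extension, `G` acts on the embeddings into an algebraic closure through the same
permutations as the automorphism group of the algebraic closure. -/
theorem IsGExtension.exists_equiv_embeddings (h : IsGExtension K F G) :
    ∃ e : α ≃ (F →ₐ[K] AlgebraicClosure K),
      (∀ γ : AlgebraicClosure K ≃ₐ[K] AlgebraicClosure K, ∃ g ∈ G, ∀ a,
        e (g a) = γ.toAlgHom.comp (e a)) ∧
      (∀ g ∈ G, ∃ γ : AlgebraicClosure K ≃ₐ[K] AlgebraicClosure K, ∀ a,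
        e (g a) = γ.toAlgHom.comp (e a)) := by
  obtain ⟨φ, e, he⟩ := h.exists_permIso
  have key : ∀ (g : G) (γ : AlgebraicClosure K ≃ₐ[K] AlgebraicClosure K),
      φ g = γ.restrictNormal (normalClosure K F (AlgebraicClosure K)) → ∀ a,
      normalClosure.algHomEquiv K F _ (e ((g : Equiv.Perm α) a)) =
        γ.toAlgHom.comp (normalClosure.algHomEquiv K F _ (e a)) := by
    intro g γ hg a
    rw [he, hg, restrictNormal_comp_algHomEquiv_symm]
  refine ⟨e.trans (normalClosure.algHomEquiv K F _), fun γ => ?_, fun g hg => ?_⟩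
  · exact ⟨φ.symm (γ.restrictNormal _), SetLike.coe_mem _, key _ _ (by simp)⟩
  · obtain ⟨γ, hγ⟩ := AlgEquiv.restrictNormalHom_surjective (F := K)
      (K₁ := normalClosure K F (AlgebraicClosure K)) (AlgebraicClosure K) (φ ⟨g, hg⟩)
    exact ⟨γ, key ⟨g, hg⟩ γ hγ.symm⟩

/-- The set where `σ` and `τ` agree is the fixed field of the group generated by `τ⁻¹ * σ`. It
contains the images of all embeddings of `F`, and these generate the normal closure. -/
theorem eq_of_comp_eq_of_normalClosure {E : Type*} [Field E] [Algebra K E] [Normal K E]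
    {σ τ : normalClosure K F E ≃ₐ[K] normalClosure K F E}
    (h : ∀ f : F →ₐ[K] normalClosure K F E, σ.toAlgHom.comp f = τ.toAlgHom.comp f) : σ = τ := by
  let L : IntermediateField K (normalClosure K F E) := fixedField (Subgroup.zpowers (τ⁻¹ * σ))
  have hmem : ∀ x, x ∈ L ↔ σ x = τ x := by
    intro x
    have hx : σ x = τ x ↔ (τ⁻¹ * σ) x = x := by
      rw [AlgEquiv.mul_apply, ← τ.injective.eq_iff (a := τ⁻¹ (σ x)),
        ← AlgEquiv.mul_apply, mul_inv_cancel]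
      rfl
    rw [hx]
    constructor
    · exact fun h => h ⟨_, Subgroup.mem_zpowers _⟩
    · intro h ρ
      have hle : Subgroup.zpowers (τ⁻¹ * σ) ≤
          MulAction.stabilizer (normalClosure K F E ≃ₐ[K] normalClosure K F E) x :=
        Subgroup.zpowers_le.2 h
      exact hle ρ.2
  have hle : normalClosure K F E ≤ L.map (normalClosure K F E).val := by
    refine normalClosure_le_iff.2 fun f => ?_
    rintro _ ⟨x, rfl⟩
    exact ⟨_, (hmem _).2 (DFunLike.congr_fun (h ((normalClosure.algHomEquiv K F E).symm f)) x), rfl⟩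
  ext x
  obtain ⟨y, hy, hyx⟩ := hle x.2
  obtain rfl : y = x := Subtype.ext hyx
  exact congrArg _ ((hmem y).1 hy)

/-- Converse of `IsGExtension.exists_equiv_embeddings`. The relation `e (g a) = γ ∘ e a` determines
`g` from `γ`, and determines the restriction of `γ` to the normal closure from `g`; it is therefore
the graph of an isomorphism. -/
theorem IsGExtension.of_equiv_embeddings [FiniteDimensional K F] [Algebra.IsSeparable K F]
    (e : α ≃ (F →ₐ[K] AlgebraicClosure K))
    (h₁ : ∀ γ : AlgebraicClosure K ≃ₐ[K] AlgebraicClosure K, ∃ g ∈ G, ∀ a,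
      e (g a) = γ.toAlgHom.comp (e a))
    (h₂ : ∀ g ∈ G, ∃ γ : AlgebraicClosure K ≃ₐ[K] AlgebraicClosure K, ∀ a,
      e (g a) = γ.toAlgHom.comp (e a)) : IsGExtension K F G := by
  let N := normalClosure K F (AlgebraicClosure K)
  let e' : α ≃ (F →ₐ[K] N) := e.trans (normalClosure.algHomEquiv K F _).symm
  have key : ∀ (g : Equiv.Perm α) (γ : AlgebraicClosure K ≃ₐ[K] AlgebraicClosure K),
      (∀ a, e (g a) = γ.toAlgHom.comp (e a)) ↔
        ∀ a, e' (g a) = (γ.restrictNormal N).toAlgHom.comp (e' a) := by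
    intro g γ
    refine forall_congr' fun a => ?_
    rw [← (normalClosure.algHomEquiv K F (AlgebraicClosure K)).injective.eq_iff,
      restrictNormal_comp_algHomEquiv_symm]
    simp [e']
  have h₁' : ∀ σ : N ≃ₐ[K] N, ∃ g ∈ G, ∀ a, e' (g a) = σ.toAlgHom.comp (e' a) := by
    intro σ
    obtain ⟨γ, rfl⟩ := AlgEquiv.restrictNormalHom_surjective (F := K)
      (K₁ := N) (AlgebraicClosure K) σ
    obtain ⟨g, hg, hgγ⟩ := h₁ γ
    exact ⟨g, hg, (key g γ).1 hgγ⟩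
  have h₂' : ∀ g : G, ∃ σ : N ≃ₐ[K] N, ∀ a, e' (g.1 a) = σ.toAlgHom.comp (e' a) := by
    intro g
    obtain ⟨γ, hγ⟩ := h₂ g g.2
    exact ⟨_, (key g γ).1 hγ⟩
  choose φ hφ using h₂'
  refine ⟨inferInstance, inferInstance,
    MulEquiv.ofBijective (MonoidHom.mk' φ fun g g' => ?_) ⟨fun g g' hgg' => ?_, fun σ => ?_⟩,
    e', fun g a => hφ g a⟩
  · refine eq_of_comp_eq_of_normalClosure fun f => ?_
    obtain ⟨a, rfl⟩ := e'.surjective f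
    rw [← hφ]
    change e' (g.1 (g'.1 a)) = (φ g).toAlgHom.comp ((φ g').toAlgHom.comp (e' a))
    rw [hφ, hφ]
  · refine Subtype.ext (Equiv.ext fun a => e'.injective ?_)
    rw [hφ, hφ]
    exact congrArg (fun σ : N ≃ₐ[K] N => σ.toAlgHom.comp (e' a)) hgg'
  · obtain ⟨g, hg, hgσ⟩ := h₁' σ
    refine ⟨⟨g, hg⟩, eq_of_comp_eq_of_normalClosure fun f => ?_⟩
    obtain ⟨a, rfl⟩ := e'.surjective f
    rw [← hgσ]
    exact (hφ ⟨g, hg⟩ a).symm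

theorem IsGExtension.map_permCongr {β : Type*} (e : α ≃ β) (h : IsGExtension K F G) :
    IsGExtension K F (G.map (e.permCongrHom : Equiv.Perm α →* Equiv.Perm β)) := by
  have := h.finiteDimensional
  have := h.isSeparable
  obtain ⟨f, h₁, h₂⟩ := h.exists_equiv_embeddings
  refine .of_equiv_embeddings (e.symm.trans f) (fun γ => ?_) ?_
  · obtain ⟨g, hg, hgγ⟩ := h₁ γ
    exact ⟨e.permCongr g, ⟨g, hg, rfl⟩, fun b => by simp [hgγ]⟩
  · rintro _ ⟨g, hg, rfl⟩
    obtain ⟨γ, hγ⟩ := h₂ g hg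
    exact ⟨γ, fun b => by simp [hγ]⟩

theorem StrongQuestion.map_permCongr {β : Type*} [Finite α] (e : α ≃ β) (h : StrongQuestion G) :
    StrongQuestion (G.map (e.permCongrHom : Equiv.Perm α →* Equiv.Perm β)) := by
  intro N hN
  obtain ⟨F, _, _, hF, hF'⟩ := h N hN
  refine ⟨F, inferInstance, inferInstance, hF.map_permCongr e, ?_⟩
  rwa [generatorIndex_map_permCongr]

/-- A Galois extension is a `G`-extension for the regular permutation representation `G` of its
Galois group. -/
theorem isGExtension_range_toPermHom [FiniteDimensional K F] [IsGalois K F] {Γ : Type*} [Group Γ]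
    (θ : Γ ≃* (F ≃ₐ[K] F)) : IsGExtension K F (MulAction.toPermHom Γ Γ).range := by
  let ι : F →ₐ[K] AlgebraicClosure K := IsAlgClosed.lift
  let _ := ι.toRingHom.toAlgebra
  have : IsScalarTower K F (AlgebraicClosure K) := .of_algHom ι
  let e : Γ ≃ (F →ₐ[K] AlgebraicClosure K) := .ofBijective
    (fun c => ι.comp (θ c).toAlgHom) ⟨fun c d hcd => ?_, fun f => ?_⟩
  · have key : ∀ (γ : AlgebraicClosure K ≃ₐ[K] AlgebraicClosure K) (c : Γ),
        γ.toAlgHom.comp (e c) = e (θ.symm (γ.restrictNormal F) * c) := by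
      intro γ c
      ext x
      have := (γ.restrictNormal_commutes F (θ c x)).symm
      change γ (ι (θ c x)) = ι (θ (θ.symm (γ.restrictNormal F) * c) x)
      rw [map_mul, MulEquiv.apply_symm_apply]
      exact this
    refine .of_equiv_embeddings e (fun γ => ?_) ?_
    · exact ⟨_, ⟨θ.symm (γ.restrictNormal F), rfl⟩, fun c => (key γ c).symm⟩
    · rintro _ ⟨d, rfl⟩
      obtain ⟨γ, hγ⟩ := AlgEquiv.restrictNormalHom_surjective (F := K) (K₁ := F)
        (AlgebraicClosure K) (θ d)
      refine ⟨γ, fun c => ?_⟩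
      rw [key, show γ.restrictNormal F = θ d from hγ]
      simp
  · refine θ.injective (AlgEquiv.ext fun x => ι.injective ?_)
    exact DFunLike.congr_fun hcd x
  · refine ⟨θ.symm (f.restrictNormal' F), AlgHom.ext fun x => ?_⟩
    change ι (θ (θ.symm (f.restrictNormal' F)) x) = f x
    rw [MulEquiv.apply_symm_apply]
    exact f.restrictNormal_commutes F x

end GExtension

end

section

open IntermediateField NumberField Module

/-! ### Ramification in the Galois closure -/

section Inertia

variable {F : Type*} [Field F] [NumberField F] {E : Type*} [Field E] [CharZero E]

section

variable (E)

instance numberFieldNormalClosure : NumberField (normalClosure ℚ F E) where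

end

variable [IsAlgClosed E]

/-- The discriminant is the square of the determinant of the conjugates of an integral basis. -/
theorem discr_eq_det_mapRingHom_pow_two
    (e : Free.ChooseBasisIndex ℤ (𝓞 F) ≃ (F →ₐ[ℚ] normalClosure ℚ F E)) :
    ((discr F : ℤ) : 𝓞 (normalClosure ℚ F E)) =
      (Matrix.of fun j i => RingOfIntegers.mapRingHom (e j).toRingHom
        (RingOfIntegers.basis F i)).det ^ 2 := by
  let N := normalClosure ℚ F E
  let i : 𝓞 N →+* E := (algebraMap N E).comp (algebraMap (𝓞 N) N)
  have hi : Function.Injective i :=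
    (algebraMap N E).injective.comp (FaithfulSMul.algebraMap_injective (𝓞 N) N)
  apply hi
  have h := Algebra.discr_eq_det_embeddingsMatrixReindex_pow_two ℚ E
    (integralBasis F) (e.trans (normalClosure.algHomEquiv ℚ F E))
  rw [← coe_discr] at h
  rw [map_intCast, map_pow, RingHom.map_det, ← Matrix.det_transpose]
  refine Eq.trans ?_ (h.trans (congrArg (fun A : Matrix _ _ E => A.det ^ 2) ?_))
  · simp
  · ext a b
    simp only [Algebra.embeddingsMatrixReindex, Algebra.embeddingsMatrix, integralBasis_apply]
    rfl

theorem card_algHom_normalClosure :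
    Nat.card (F →ₐ[ℚ] normalClosure ℚ F E) = finrank ℚ F := by
  refine (Nat.card_congr (normalClosure.algHomEquiv ℚ F E)).trans ?_
  rw [Nat.card_eq_fintype_card, AlgHom.card]

variable [Normal ℚ E]

/-- If `p` does not divide the discriminant of `F`, the inertia groups at `p` in the Galois closure
of `F` are trivial. -/
theorem inertia_normalClosure_eq_bot {p : ℤ} (hp : Prime p) (hpF : ¬ p ∣ discr F)
    (P : Ideal (𝓞 (normalClosure ℚ F E))) [P.IsPrime]
    (hpP : (p : 𝓞 (normalClosure ℚ F E)) ∈ P) :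
    P.inertia Gal(normalClosure ℚ F E/ℚ) = ⊥ := by
  rw [eq_bot_iff]
  intro σ hσ
  rw [Subgroup.mem_bot]
  refine eq_of_comp_eq_of_normalClosure fun f => ?_
  by_contra hne
  have hcard : Nat.card (Free.ChooseBasisIndex ℤ (𝓞 F)) =
      Nat.card (F →ₐ[ℚ] normalClosure ℚ F E) := by
    rw [card_algHom_normalClosure, Nat.card_eq_fintype_card,
      ← finrank_eq_card_basis (integralBasis F)]
  let e : Free.ChooseBasisIndex ℤ (𝓞 F) ≃ (F →ₐ[ℚ] normalClosure ℚ F E) :=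
    (Finite.card_eq.1 hcard).some
  have hdet := discr_eq_det_mapRingHom_pow_two e
  have hmem : ((discr F : ℤ) : 𝓞 (normalClosure ℚ F E)) ∈ P := by
    rw [hdet]
    refine P.pow_mem_of_mem ?_ 2 two_pos
    rw [← Ideal.Quotient.eq_zero_iff_mem, RingHom.map_det]
    obtain ⟨j, hj⟩ := e.surjective f
    obtain ⟨k, hk⟩ := e.surjective (σ.toAlgHom.comp f)
    -- Inertia acts trivially modulo `P`, so the distinct embeddings `f` and `σ ∘ f` give two equal
    -- rows modulo `P`.
    refine Matrix.det_zero_of_row_eq (i := k) (j := j) ?_ ?_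
    · rintro rfl
      exact hne (hk.symm.trans hj)
    · ext i
      refine (Ideal.Quotient.eq).2 ?_
      have := hσ (RingOfIntegers.mapRingHom f.toRingHom (RingOfIntegers.basis F i))
      simp only [Matrix.of_apply, hj, hk]
      exact this
  have hcop : IsCoprime p (discr F) := (Prime.coprime_iff_not_dvd hp).2 hpF
  obtain ⟨u, v, huv⟩ := hcop
  refine Ideal.IsPrime.ne_top ‹P.IsPrime› ((Ideal.eq_top_iff_one _).2 ?_)
  have : ((u * p + v * discr F : ℤ) : 𝓞 (normalClosure ℚ F E)) ∈ P := by
    push_cast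
    exact P.add_mem (P.mul_mem_left _ hpP) (P.mul_mem_left _ hmem)
  simpa [huv] using this

theorem not_dvd_discr_normalClosure {p : ℤ} (hp : Prime p) (hpF : ¬ p ∣ discr F) :
    ¬ p ∣ discr (normalClosure ℚ F E) := by
  let N := normalClosure ℚ F E
  rw [not_dvd_discr_iff_forall_liesOver N (𝓞 N) hp]
  intro P hP hPp
  have := hP.isPrime
  have : IsGalois ℚ N := { to_isSeparable := inferInstance, to_normal := normalClosure.normal ℚ F E }
  have hpP : (p : 𝓞 N) ∈ P := (Ideal.liesOver_span_iff hP.ne_top hp).1 hPp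
  have := (Ideal.span_singleton_prime hp.ne_zero).2 hp
  rw [← Ideal.ramificationIdx_eq_one_iff,
    ← Ideal.ramificationIdxIn_eq_ramificationIdx (Ideal.span {p}) P Gal(N/ℚ),
    ← Ideal.card_inertia_eq_ramificationIdxIn (G := Gal(N/ℚ)) (Ideal.span {p}) P,
    inertia_normalClosure_eq_bot hp hpF P hpP]
  simp

end Inertia

end

section

open IntermediateField NumberField Module

/-! ### Compositum of fields with coprime discriminants -/

section Compositum

variable {F₁ F₂ : Type*} [Field F₁] [NumberField F₁] [Field F₂] [NumberField F₂]
  {E : Type*} [Field E] [CharZero E] [IsAlgClosed E] [Normal ℚ E]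

theorem isCoprime_discr_normalClosure (h : IsCoprime (discr F₁) (discr F₂)) :
    IsCoprime (discr (normalClosure ℚ F₁ E)) (discr (normalClosure ℚ F₂ E)) := by
  refine isCoprime_of_prime_dvd (fun h0 => discr_ne_zero _ h0.1) fun p hp h₁ h₂ => ?_
  have h₁' : p ∣ discr F₁ := by
    by_contra hn
    exact not_dvd_discr_normalClosure hp hn h₁
  have h₂' : p ∣ discr F₂ := by
    by_contra hn
    exact not_dvd_discr_normalClosure hp hn h₂
  exact hp.not_isUnit (h.isUnit_of_dvd' h₁' h₂')

/-- The discriminant of the intersection divides both discriminants, hence is a unit. Minkowski's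
bound excludes this in degree greater than one. -/
theorem inf_eq_bot_of_isCoprime_discr {K : Type*} [Field K] [CharZero K]
    (L₁ L₂ : IntermediateField ℚ K) [NumberField L₁] [NumberField L₂]
    (h : IsCoprime (discr L₁) (discr L₂)) : L₁ ⊓ L₂ = ⊥ := by
  let i₁ : ↥(L₁ ⊓ L₂) →ₐ[ℚ] L₁ := inclusion inf_le_left
  let i₂ : ↥(L₁ ⊓ L₂) →ₐ[ℚ] L₂ := inclusion inf_le_right
  have : FiniteDimensional ℚ ↥(L₁ ⊓ L₂) := .of_injective i₁.toLinearMap i₁.injective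
  have : NumberField ↥(L₁ ⊓ L₂) := {}
  have hunit : IsUnit (discr ↥(L₁ ⊓ L₂)) := by
    refine h.isUnit_of_dvd' ?_ ?_
    · let _ := i₁.toRingHom.toAlgebra
      exact discr_dvd_discr _ _
    · let _ := i₂.toRingHom.toAlgebra
      exact discr_dvd_discr _ _
  by_contra hne
  have hrank : 1 < finrank ℚ ↥(L₁ ⊓ L₂) := by
    refine Nat.one_lt_iff_ne_zero_and_ne_one.2 ⟨finrank_pos.ne', ?_⟩
    rwa [ne_eq, IntermediateField.finrank_eq_one_iff]
  have := abs_discr_gt_two hrank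
  rw [Int.isUnit_iff_abs_eq.1 hunit] at this
  norm_num at this

/-- Restricting the automorphisms that fix `L₂` to `L₁` gives a subgroup of `Gal(L₁/k)` with fixed
field `L₁ ⊓ L₂ = k`. By the Galois correspondence it is the whole group. -/
theorem exists_algEquiv_eqOn_of_inf_eq_bot {k K : Type*} [Field k] [Field K] [Algebra k K]
    [IsGalois k K] (L₁ L₂ : IntermediateField k K) [Normal k L₁] [FiniteDimensional k L₁]
    (h : L₁ ⊓ L₂ = ⊥) (σ : Gal(K/k)) :
    ∃ τ : Gal(K/k), (∀ x ∈ L₁, τ x = σ x) ∧ ∀ x ∈ L₂, τ x = x := by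
  let R : Subgroup Gal(L₁/k) := L₂.fixingSubgroup.map (AlgEquiv.restrictNormalHom L₁)
  have hR : fixedField R = ⊥ := by
    refine eq_bot_iff.2 fun ⟨x, hx₁⟩ hx₂ => ?_
    have hx : x ∈ fixedField L₂.fixingSubgroup := by
      rintro ⟨τ, hτ⟩
      have := hx₂ ⟨_, Subgroup.mem_map_of_mem (AlgEquiv.restrictNormalHom L₁) hτ⟩
      have := congrArg (algebraMap L₁ K) this
      exact (τ.restrictNormal_commutes L₁ ⟨x, hx₁⟩).symm.trans this
    rw [InfiniteGalois.fixedField_fixingSubgroup] at hx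
    obtain ⟨z, rfl⟩ : x ∈ (⊥ : IntermediateField k K) := h ▸ mem_inf.2 ⟨hx₁, hx⟩
    exact mem_bot.2 ⟨z, rfl⟩
  have hmem : AlgEquiv.restrictNormalHom L₁ σ ∈ R := by
    rw [← fixingSubgroup_fixedField R, hR, fixingSubgroup_bot]
    trivial
  obtain ⟨τ, hτ, hτσ⟩ := hmem
  refine ⟨τ, fun x hx => ?_, fun x hx => hτ ⟨x, hx⟩⟩
  have := congrArg (algebraMap L₁ K) (DFunLike.congr_fun hτσ ⟨x, hx⟩)
  exact (τ.restrictNormal_commutes L₁ ⟨x, hx⟩).symm.trans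
    (this.trans (σ.restrictNormal_commutes L₁ ⟨x, hx⟩))

theorem exists_algEquiv_comp_eq_comp (h : IsCoprime (discr F₁) (discr F₂)) (γ₁ γ₂ : Gal(E/ℚ)) :
    ∃ γ : Gal(E/ℚ), (∀ f : F₁ →ₐ[ℚ] E, γ.toAlgHom.comp f = γ₁.toAlgHom.comp f) ∧
      ∀ f : F₂ →ₐ[ℚ] E, γ.toAlgHom.comp f = γ₂.toAlgHom.comp f := by
  have : IsGalois ℚ E := {}
  have hinf := inf_eq_bot_of_isCoprime_discr _ _ (isCoprime_discr_normalClosure (E := E) h)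
  -- With `τ` equal to `γ₂⁻¹ * γ₁` on the first closure and to the identity on the second, `γ₂ * τ`
  -- agrees with `γ₁` and `γ₂` respectively.
  obtain ⟨τ, hτ₁, hτ₂⟩ := exists_algEquiv_eqOn_of_inf_eq_bot _ _ hinf (γ₂⁻¹ * γ₁)
  refine ⟨γ₂ * τ, fun f => AlgHom.ext fun x => ?_, fun f => AlgHom.ext fun x => ?_⟩
  · have := hτ₁ (f x) (f.fieldRange_le_normalClosure ⟨x, rfl⟩)
    change γ₂ (τ (f x)) = γ₁ (f x)
    rw [this]
    exact γ₂.apply_symm_apply (γ₁ (f x))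
  · exact congrArg γ₂ (hτ₂ (f x) (f.fieldRange_le_normalClosure ⟨x, rfl⟩))

theorem exists_algEquiv_comp_eq {K F E : Type*} [Field K] [Field F] [Field E] [Algebra K F]
    [Algebra K E] [Normal K E] (f g : F →ₐ[K] E) : ∃ γ : Gal(E/K), γ.toAlgHom.comp f = g := by
  let χ : f.fieldRange ≃ₐ[K] g.fieldRange :=
    (AlgEquiv.ofInjectiveField f).symm.trans (AlgEquiv.ofInjectiveField g)
  refine ⟨χ.liftNormal E, AlgHom.ext fun x => ?_⟩
  have := χ.liftNormal_commutes E (AlgEquiv.ofInjectiveField f x)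
  rwa [show χ (AlgEquiv.ofInjectiveField f x) = AlgEquiv.ofInjectiveField g x from
    congrArg (AlgEquiv.ofInjectiveField g) (AlgEquiv.symm_apply_apply _ x)] at this

theorem algHom_ext_of_sup_fieldRange_eq_top {K F₁ F₂ F E : Type*} [Field K] [Field F₁] [Field F₂]
    [Field F] [Field E] [Algebra K F₁] [Algebra K F₂] [Algebra K F] [Algebra K E]
    {j₁ : F₁ →ₐ[K] F} {j₂ : F₂ →ₐ[K] F} (hj : j₁.fieldRange ⊔ j₂.fieldRange = ⊤)
    {f g : F →ₐ[K] E} (h₁ : f.comp j₁ = g.comp j₁) (h₂ : f.comp j₂ = g.comp j₂) : f = g := by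
  let L : IntermediateField K F :=
    { AlgHom.equalizer f g with
      inv_mem' := fun x (hx : f x = g x) => show f x⁻¹ = g x⁻¹ by rw [map_inv₀, map_inv₀, hx] }
  have hL : ⊤ ≤ L := by
    rw [← hj]
    refine sup_le ?_ ?_
    · rintro _ ⟨x, rfl⟩
      exact DFunLike.congr_fun h₁ x
    · rintro _ ⟨x, rfl⟩
      exact DFunLike.congr_fun h₂ x
  exact AlgHom.ext fun x => hL (mem_top (x := x))

theorem sup_fieldRange_eq_top_of_val_comp_eq {K F₁ F₂ E : Type*} [Field K] [Field F₁] [Field F₂]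
    [Field E] [Algebra K F₁] [Algebra K F₂] [Algebra K E] (i₁ : F₁ →ₐ[K] E) (i₂ : F₂ →ₐ[K] E)
    {j₁ : F₁ →ₐ[K] ↥(i₁.fieldRange ⊔ i₂.fieldRange)}
    {j₂ : F₂ →ₐ[K] ↥(i₁.fieldRange ⊔ i₂.fieldRange)}
    (h₁ : (i₁.fieldRange ⊔ i₂.fieldRange).val.comp j₁ = i₁)
    (h₂ : (i₁.fieldRange ⊔ i₂.fieldRange).val.comp j₂ = i₂) :
    j₁.fieldRange ⊔ j₂.fieldRange = ⊤ := by
  apply map_injective (i₁.fieldRange ⊔ i₂.fieldRange).val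
  rw [IntermediateField.map_sup, AlgHom.map_fieldRange, AlgHom.map_fieldRange,
    ← AlgHom.fieldRange_eq_map, fieldRange_val, h₁, h₂]

variable (F₁ F₂ E) in
/-- Number fields with coprime discriminants have a compositum whose embeddings are the pairs of
embeddings of the two fields, and its discriminant is determined by theirs. -/
theorem exists_compositum (h : IsCoprime (discr F₁) (discr F₂)) :
    ∃ (F : IntermediateField ℚ E) (_ : NumberField F) (j₁ : F₁ →ₐ[ℚ] F) (j₂ : F₂ →ₐ[ℚ] F),
      Function.Bijective (fun f : F →ₐ[ℚ] E => (f.comp j₁, f.comp j₂)) ∧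
      (discr F).natAbs =
        (discr F₁).natAbs ^ finrank ℚ F₂ * (discr F₂).natAbs ^ finrank ℚ F₁ := by
  let i₁ : F₁ →ₐ[ℚ] E := IsAlgClosed.lift
  let i₂ : F₂ →ₐ[ℚ] E := IsAlgClosed.lift
  let F : IntermediateField ℚ E := i₁.fieldRange ⊔ i₂.fieldRange
  have : FiniteDimensional ℚ i₁.fieldRange := i₁.toLinearMap.finiteDimensional_range
  have : FiniteDimensional ℚ i₂.fieldRange := i₂.toLinearMap.finiteDimensional_range
  have : NumberField F := {to_finiteDimensional := finiteDimensional_sup _ _}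
  let j₁ : F₁ →ₐ[ℚ] F := i₁.codRestrict F.toSubalgebra fun x =>
    (le_sup_left : i₁.fieldRange ≤ F) ⟨x, rfl⟩
  let j₂ : F₂ →ₐ[ℚ] F := i₂.codRestrict F.toSubalgebra fun x =>
    (le_sup_right : i₂.fieldRange ≤ F) ⟨x, rfl⟩
  have hj : j₁.fieldRange ⊔ j₂.fieldRange = ⊤ := sup_fieldRange_eq_top_of_val_comp_eq i₁ i₂ rfl rfl
  have hbij : Function.Bijective (fun f : F →ₐ[ℚ] E => (f.comp j₁, f.comp j₂)) := by
    refine ⟨fun f g hfg => algHom_ext_of_sup_fieldRange_eq_top hj (congrArg Prod.fst hfg)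
      (congrArg Prod.snd hfg), fun ⟨f₁, f₂⟩ => ?_⟩
    obtain ⟨γ₁, rfl⟩ := exists_algEquiv_comp_eq i₁ f₁
    obtain ⟨γ₂, rfl⟩ := exists_algEquiv_comp_eq i₂ f₂
    obtain ⟨γ, h₁, h₂⟩ := exists_algEquiv_comp_eq_comp h γ₁ γ₂
    exact ⟨γ.toAlgHom.comp F.val, Prod.ext (h₁ i₁) (h₂ i₂)⟩
  -- Counting embeddings gives the degree, which is what linear disjointness below requires.
  have hcard : finrank ℚ F = finrank ℚ F₁ * finrank ℚ F₂ := by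
    rw [← AlgHom.card ℚ F E, ← AlgHom.card ℚ F₁ E, ← AlgHom.card ℚ F₂ E, ← Fintype.card_prod]
    exact Fintype.card_congr (Equiv.ofBijective _ hbij)
  let e₁ : F₁ ≃ₐ[ℚ] j₁.fieldRange := AlgEquiv.ofInjectiveField j₁
  let e₂ : F₂ ≃ₐ[ℚ] j₂.fieldRange := AlgEquiv.ofInjectiveField j₂
  refine ⟨F, inferInstance, j₁, j₂, hbij, ?_⟩
  rw [discr_eq_discr_of_algEquiv _ e₁, discr_eq_discr_of_algEquiv _ e₂,
    e₁.toLinearEquiv.finrank_eq, e₂.toLinearEquiv.finrank_eq]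
  refine natAbs_discr_eq_natAbs_discr_pow_mul_natAbs_discr_pow F _ _
    (.of_finrank_sup ?_) hj (isCoprime_differentIdeal_of_isCoprime_discr F ?_)
  · rw [hj, finrank_top', hcard, e₁.toLinearEquiv.finrank_eq, e₂.toLinearEquiv.finrank_eq]
  · rwa [← discr_eq_discr_of_algEquiv _ e₁, ← discr_eq_discr_of_algEquiv _ e₂]

end Compositum

end

section

open IntermediateField NumberField Module

/-! ### Ring embeddings over `ℚ` and products of `G`-extensions -/

section RatEmbeddings

variable {F : Type*} [Field F] [NumberField F] {α : Type*} {G : Subgroup (Equiv.Perm α)}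

/-- Ring homomorphisms between fields of characteristic zero are automatically `ℚ`-linear; this form
does not depend on which `ℚ`-algebra structure `AlgebraicClosure ℚ` carries. -/
theorem isGExtension_rat_iff : IsGExtension ℚ F G ↔
    ∃ e : α ≃ (F →+* AlgebraicClosure ℚ),
      (∀ γ : AlgebraicClosure ℚ ≃+* AlgebraicClosure ℚ, ∃ g ∈ G, ∀ a,
        e (g a) = (γ : AlgebraicClosure ℚ →+* AlgebraicClosure ℚ).comp (e a)) ∧
      (∀ g ∈ G, ∃ γ : AlgebraicClosure ℚ ≃+* AlgebraicClosure ℚ, ∀ a,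
        e (g a) = (γ : AlgebraicClosure ℚ →+* AlgebraicClosure ℚ).comp (e a)) := by
  constructor
  · intro h
    obtain ⟨e, h₁, h₂⟩ := h.exists_equiv_embeddings
    refine ⟨e.trans (RingHom.equivRatAlgHom _ _).symm, fun γ => ?_, fun g hg => ?_⟩
    · obtain ⟨g, hg, hgγ⟩ := h₁ (AlgEquiv.ofRingEquiv (f := γ) fun x => by simp)
      exact ⟨g, hg, fun a => congrArg AlgHom.toRingHom (hgγ a)⟩
    · obtain ⟨γ, hγ⟩ := h₂ g hg
      exact ⟨γ.toRingEquiv, fun a => congrArg AlgHom.toRingHom (hγ a)⟩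
  · rintro ⟨e, h₁, h₂⟩
    refine .of_equiv_embeddings (e.trans (RingHom.equivRatAlgHom _ _)) (fun γ => ?_) fun g hg => ?_
    · obtain ⟨g, hg, hgγ⟩ := h₁ γ.toRingEquiv
      exact ⟨g, hg, fun a => AlgHom.coe_ringHom_injective (hgγ a)⟩
    · obtain ⟨γ, hγ⟩ := h₂ g hg
      exact ⟨AlgEquiv.ofRingEquiv (f := γ) fun x => by simp,
        fun a => AlgHom.coe_ringHom_injective (hγ a)⟩

theorem IsGExtension.finrank_eq_card (h : IsGExtension ℚ F G) : finrank ℚ F = Nat.card α := by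
  obtain ⟨e, -⟩ := isGExtension_rat_iff.1 h
  rw [Nat.card_congr (e.trans (RingHom.equivRatAlgHom _ _)), Nat.card_eq_fintype_card, AlgHom.card]

end RatEmbeddings

section Compositum

theorem normal_rat_algebraicClosure : Normal ℚ (AlgebraicClosure ℚ) := by
  have h : ∀ (K : Type) [Field K], Normal K (AlgebraicClosure K) := fun _ _ => inferInstance
  convert h ℚ
  exact Subsingleton.elim _ _

variable {F₁ F₂ : Type*} [Field F₁] [NumberField F₁] [Field F₂] [NumberField F₂]

theorem exists_ringEquiv_comp_eq_comp {E : Type*} [Field E] [CharZero E] [IsAlgClosed E]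
    [Normal ℚ E] (h : IsCoprime (discr F₁) (discr F₂)) (γ₁ γ₂ : E ≃+* E) :
    ∃ γ : E ≃+* E, (∀ f : F₁ →+* E, (γ : E →+* E).comp f = (γ₁ : E →+* E).comp f) ∧
      ∀ f : F₂ →+* E, (γ : E →+* E).comp f = (γ₂ : E →+* E).comp f := by
  obtain ⟨γ, h₁, h₂⟩ := exists_algEquiv_comp_eq_comp h
    (AlgEquiv.ofRingEquiv (f := γ₁) fun x => by simp)
    (AlgEquiv.ofRingEquiv (f := γ₂) fun x => by simp)
  exact ⟨γ.toRingEquiv, fun f => congrArg AlgHom.toRingHom (h₁ f.toRatAlgHom),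
    fun f => congrArg AlgHom.toRingHom (h₂ f.toRatAlgHom)⟩

variable (F₁ F₂) in
theorem exists_compositum_ringHom (E : Type*) [Field E] [CharZero E] [IsAlgClosed E]
    [Normal ℚ E] (h : IsCoprime (discr F₁) (discr F₂)) :
    ∃ (F : IntermediateField ℚ E) (_ : NumberField F) (j₁ : F₁ →+* F) (j₂ : F₂ →+* F),
      Function.Bijective (fun f : F →+* E => (f.comp j₁, f.comp j₂)) ∧
      (discr F).natAbs =
        (discr F₁).natAbs ^ finrank ℚ F₂ * (discr F₂).natAbs ^ finrank ℚ F₁ := by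
  obtain ⟨F, hF, j₁, j₂, hbij, hd⟩ := exists_compositum F₁ F₂ E h
  refine ⟨F, hF, j₁, j₂, ?_, hd⟩
  have := ((RingHom.equivRatAlgHom F₁ E).symm.prodCongr
    (RingHom.equivRatAlgHom F₂ E).symm).bijective.comp
      (hbij.comp (RingHom.equivRatAlgHom F E).bijective)
  exact this

end Compositum

/-! ### Power-free discriminants and the product step -/

theorem IsPowerFree.ne_zero {k : ℕ} {d : ℤ} (h : IsPowerFree k d) : d ≠ 0 := by
  rintro rfl
  exact h 2 Nat.prime_two (dvd_zero _)

theorem IsPowerFree.not_pow_dvd_natAbs_pow {d : ℤ} {e : ℕ} (h : IsPowerFree (e + 1) d) (a : ℕ)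
    {p : ℕ} (hp : p.Prime) : ¬ p ^ (a * e + 1) ∣ d.natAbs ^ a := by
  have h0 : d.natAbs ≠ 0 := Int.natAbs_ne_zero.2 h.ne_zero
  have hd : ¬ p ^ (e + 1) ∣ d.natAbs := fun hdvd =>
    h p hp (by exact_mod_cast Int.natCast_dvd.2 hdvd)
  rw [hp.pow_dvd_iff_le_factorization h0, not_le, Nat.lt_succ_iff] at hd
  rw [hp.pow_dvd_iff_le_factorization (pow_ne_zero a h0), not_le, Nat.factorization_pow,
    Finsupp.smul_apply, smul_eq_mul, Nat.lt_succ_iff]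
  exact Nat.mul_le_mul_left a hd

/-- A prime divides at most one of `d₁`, `d₂`, so its exponent in `d` is at most `a * e₁` or at most
`b * e₂`. -/
theorem isPowerFree_of_natAbs_eq {d d₁ d₂ : ℤ} {a b e₁ e₂ : ℕ} (hc : IsCoprime d₁ d₂)
    (h₁ : IsPowerFree (e₁ + 1) d₁) (h₂ : IsPowerFree (e₂ + 1) d₂)
    (hd : d.natAbs = d₁.natAbs ^ a * d₂.natAbs ^ b) :
    IsPowerFree (max (a * e₁) (b * e₂) + 1) d := by
  intro p hp hdvd
  have hdvd' : p ^ (max (a * e₁) (b * e₂) + 1) ∣ d₁.natAbs ^ a * d₂.natAbs ^ b := by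
    rw [← hd]
    exact Int.natCast_dvd.1 (by exact_mod_cast hdvd)
  have hc' : Nat.Coprime d₁.natAbs d₂.natAbs := Int.isCoprime_iff_gcd_eq_one.1 hc
  by_cases hp₁ : p ∣ d₁.natAbs
  · have hcop : Nat.Coprime (p ^ (max (a * e₁) (b * e₂) + 1)) (d₂.natAbs ^ b) :=
      Nat.Coprime.pow _ _ (hc'.coprime_dvd_left hp₁)
    exact h₁.not_pow_dvd_natAbs_pow a hp ((pow_dvd_pow p (by omega)).trans
      (hcop.dvd_of_dvd_mul_right hdvd'))
  · have hcop : Nat.Coprime (p ^ (max (a * e₁) (b * e₂) + 1)) (d₁.natAbs ^ a) :=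
      Nat.Coprime.pow _ _ ((hp.coprime_iff_not_dvd).2 hp₁)
    exact h₂.not_pow_dvd_natAbs_pow b hp ((pow_dvd_pow p (by omega)).trans
      (hcop.dvd_of_dvd_mul_left hdvd'))

theorem StrongQuestion.productAction {α β : Type*} [Finite α] [Nonempty α] [Finite β] [Nonempty β]
    {G : Subgroup (Equiv.Perm α)} {H : Subgroup (Equiv.Perm β)} (hG : StrongQuestion G)
    (hH : StrongQuestion H) : StrongQuestion (productAction G H) := by
  have := normal_rat_algebraicClosure
  intro N hN
  obtain ⟨F₁, _, _, hF₁, hfree₁, hcop₁⟩ := hG N hN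
  -- Enlarging the modulus by `discr F₁` forces the two discriminants to be coprime.
  obtain ⟨F₂, _, _, hF₂, hfree₂, hcop₂⟩ := hH (N * (discr F₁).natAbs)
    (Nat.mul_pos hN (Int.natAbs_pos.2 (discr_ne_zero F₁)))
  rw [Nat.cast_mul] at hcop₂
  have hcop : IsCoprime (discr F₁) (discr F₂) := by
    have h := Int.isCoprime_iff_gcd_eq_one.1 hcop₂.of_mul_right_right
    rw [Int.gcd_def, Int.natAbs_natCast, ← Int.gcd_def] at h
    exact (Int.isCoprime_iff_gcd_eq_one.2 h).symm
  obtain ⟨F, _, j₁, j₂, hbij, hd⟩ := exists_compositum_ringHom F₁ F₂ (AlgebraicClosure ℚ) hcop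
  refine ⟨F, inferInstance, inferInstance, ?_, ?_, ?_⟩
  · obtain ⟨e₁, h₁, h₁'⟩ := isGExtension_rat_iff.1 hF₁
    obtain ⟨e₂, h₂, h₂'⟩ := isGExtension_rat_iff.1 hF₂
    let ρ := Equiv.ofBijective _ hbij
    let e := (e₁.prodCongr e₂).trans ρ.symm
    have key : ∀ (g : Equiv.Perm α) (h : Equiv.Perm β)
        (γ : AlgebraicClosure ℚ ≃+* AlgebraicClosure ℚ),
        (∀ a, e₁ (g a) = (γ : AlgebraicClosure ℚ →+* AlgebraicClosure ℚ).comp (e₁ a)) →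
        (∀ b, e₂ (h b) = (γ : AlgebraicClosure ℚ →+* AlgebraicClosure ℚ).comp (e₂ b)) →
        ∀ x, e (Equiv.prodCongr g h x) =
          (γ : AlgebraicClosure ℚ →+* AlgebraicClosure ℚ).comp (e x) := by
      intro g h γ hg hh x
      have hx : (e₁ x.1, e₂ x.2) = ((e x).comp j₁, (e x).comp j₂) :=
        (ρ.apply_symm_apply (e₁ x.1, e₂ x.2)).symm
      rw [Prod.mk.injEq] at hx
      refine hbij.1 ((ρ.apply_symm_apply (e₁ (g x.1), e₂ (h x.2))).trans (Prod.ext ?_ ?_))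
      · change e₁ (g x.1) = _
        rw [hg, hx.1]
        rfl
      · change e₂ (h x.2) = _
        rw [hh, hx.2]
        rfl
    refine isGExtension_rat_iff.2 ⟨e, fun γ => ?_, fun σ hσ => ?_⟩
    · obtain ⟨g, hg, hgγ⟩ := h₁ γ
      obtain ⟨h, hh, hhγ⟩ := h₂ γ
      exact ⟨_, mem_productAction.2 ⟨g, hg, h, hh, rfl⟩, key g h γ hgγ hhγ⟩
    · obtain ⟨g, hg, h, hh, rfl⟩ := mem_productAction.1 hσ
      obtain ⟨γ₁, hγ₁⟩ := h₁' g hg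
      obtain ⟨γ₂, hγ₂⟩ := h₂' h hh
      obtain ⟨γ, hγ, hγ'⟩ := exists_ringEquiv_comp_eq_comp hcop γ₁ γ₂
      exact ⟨γ, key g h γ (fun a => (hγ₁ a).trans (hγ _).symm) fun b => (hγ₂ b).trans (hγ' _).symm⟩
  · rw [generatorIndex_productAction, ← hF₁.finrank_eq_card, ← hF₂.finrank_eq_card]
    exact isPowerFree_of_natAbs_eq hcop hfree₁ hfree₂ hd
  · have h₁ : Nat.Coprime (discr F₁).natAbs N :=
      Int.isCoprime_iff_gcd_eq_one.1 hcop₁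
    have h₂ : Nat.Coprime (discr F₂).natAbs N :=
      Int.isCoprime_iff_gcd_eq_one.1 hcop₂.of_mul_right_left
    rw [Int.isCoprime_iff_gcd_eq_one, Int.gcd, hd]
    exact (h₁.pow_left _).mul_left (h₂.pow_left _)

end

section

open IntermediateField NumberField Module MulAction

/-! ### Regular representations and cyclic groups of prime power order -/

section Regular

theorem range_toPermHom_prod (Γ Γ' : Type*) [Group Γ] [Group Γ'] :
    (toPermHom (Γ × Γ') (Γ × Γ')).range =
      productAction (toPermHom Γ Γ).range (toPermHom Γ' Γ').range := by
  ext σ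
  rw [mem_productAction]
  constructor
  · rintro ⟨⟨x, y⟩, rfl⟩
    exact ⟨_, ⟨x, rfl⟩, _, ⟨y, rfl⟩, rfl⟩
  · rintro ⟨_, ⟨x, rfl⟩, _, ⟨y, rfl⟩, rfl⟩
    exact ⟨(x, y), rfl⟩

theorem map_permCongr_range_toPermHom {Γ Γ' : Type*} [Group Γ] [Group Γ'] (f : Γ ≃* Γ') :
    ((toPermHom Γ Γ).range).map (f.toEquiv.permCongrHom : Equiv.Perm Γ →* Equiv.Perm Γ') =
      (toPermHom Γ' Γ').range := by
  have key : ∀ x : Γ, f.toEquiv.permCongr (toPermHom Γ Γ x) = toPermHom Γ' Γ' (f x) := by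
    intro x
    ext y
    simp
  ext σ
  constructor
  · rintro ⟨_, ⟨x, rfl⟩, rfl⟩
    exact ⟨f x, (key x).symm⟩
  · rintro ⟨y, rfl⟩
    refine ⟨_, ⟨f.symm y, rfl⟩, (key _).trans ?_⟩
    rw [MulEquiv.apply_symm_apply]

/-- A transitive abelian permutation group is permutation isomorphic to its regular
representation. -/
theorem exists_equiv_map_range_toPermHom_eq {α : Type*} [Nonempty α] (A : Subgroup (Equiv.Perm α))
    (hA : IsPretransitive A α) (hcomm : ∀ x ∈ A, ∀ y ∈ A, x * y = y * x) :
    ∃ e : A ≃ α, ((toPermHom A A).range).map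
      (e.permCongrHom : Equiv.Perm A →* Equiv.Perm α) = A := by
  obtain ⟨a₀⟩ := ‹Nonempty α›
  let e : A ≃ α := .ofBijective (fun g => (g : Equiv.Perm α) a₀) ⟨fun g h hgh => ?_, fun a => ?_⟩
  · refine ⟨e, ?_⟩
    have key : ∀ g : A, e.permCongr (toPermHom A A g) = g := by
      intro g
      ext a
      obtain ⟨h, rfl⟩ := e.surjective a
      rw [Equiv.permCongr_apply, Equiv.symm_apply_apply]
      rfl
    ext σ
    constructor
    · rintro ⟨_, ⟨g, rfl⟩, rfl⟩
      exact (key g).symm ▸ g.2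
    · exact fun hσ => ⟨_, ⟨⟨σ, hσ⟩, rfl⟩, key ⟨σ, hσ⟩⟩
  · refine Subtype.ext (Equiv.ext fun a => ?_)
    obtain ⟨k, rfl⟩ := hA.exists_smul_eq a₀ a
    have h₁ := Equiv.congr_fun (hcomm g g.2 k k.2) a₀
    have h₂ := Equiv.congr_fun (hcomm h h.2 k k.2) a₀
    exact h₁.trans ((congrArg (k : Equiv.Perm α) hgh).trans h₂.symm)
  · obtain ⟨g, hg⟩ := hA.exists_smul_eq a₀ a
    exact ⟨g, hg⟩

/-- A generating set of a cyclic group of prime power order contains a generator. -/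
theorem exists_mem_zpowers_eq_top {Γ : Type*} [CommGroup Γ] [IsCyclic Γ] {p k : ℕ} (hp : p.Prime)
    (hcard : Nat.card Γ = p ^ (k + 1)) {S : Set Γ} (hS : Subgroup.closure S = ⊤) :
    ∃ s ∈ S, Subgroup.zpowers s = ⊤ := by
  have : Finite Γ := Nat.finite_of_card_ne_zero (by rw [hcard]; exact pow_ne_zero _ hp.ne_zero)
  by_contra! hne
  -- Without a generator in `S`, every element of `S` has order dividing `p ^ k`, and so would the
  -- whole group.
  have hle : Subgroup.closure S ≤ (powMonoidHom (p ^ k) : Γ →* Γ).ker := by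
    rw [Subgroup.closure_le]
    intro s hs
    obtain ⟨i, hi, his⟩ := (Nat.dvd_prime_pow hp).1 (hcard ▸ orderOf_dvd_natCard s)
    have hik : i ≤ k := by
      by_contra hik
      obtain rfl : i = k + 1 := by omega
      exact hne s hs ((Subgroup.card_eq_iff_eq_top _).1 (by rw [Nat.card_zpowers, his, hcard]))
    exact orderOf_dvd_iff_pow_eq_one.1 (his ▸ pow_dvd_pow p hik)
  rw [hS] at hle
  obtain ⟨g, hg⟩ := IsCyclic.exists_generator (α := Γ)
  have h₁ : orderOf g ∣ p ^ k := orderOf_dvd_of_pow_eq_one (hle (Subgroup.mem_top g))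
  rw [orderOf_eq_card_of_forall_mem_zpowers hg, hcard] at h₁
  exact absurd (Nat.le_of_dvd (pow_pos hp.pos k) h₁) (not_le.2 (Nat.pow_lt_pow_right hp.one_lt k.lt_succ_self))

theorem card_sub_one_le_permIndex_toPermHom {Γ : Type*} [Group Γ] [Finite Γ] {s : Γ}
    (hs : Subgroup.zpowers s = ⊤) : Nat.card Γ - 1 ≤ permIndex (toPermHom Γ Γ s) := by
  refine Nat.sub_le_sub_left ?_ _
  have : Finite (Quotient (Equiv.Perm.SameCycle.setoid (toPermHom Γ Γ s))) :=
    Finite.of_surjective _ Quotient.mk_surjective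
  refine Finite.card_le_one_iff_subsingleton.2 ⟨fun q r => ?_⟩
  induction q, r using Quotient.inductionOn₂ with
  | _ x y =>
    obtain ⟨i, hi⟩ : y * x⁻¹ ∈ Subgroup.zpowers s := hs ▸ Subgroup.mem_top _
    refine Quotient.sound ⟨i, ?_⟩
    rw [← map_zpow]
    change s ^ i * x = y
    rw [show s ^ i = y * x⁻¹ from hi, inv_mul_cancel_right]

/-- Some member of any generating set generates `Γ` and so acts by left translation as a single
cycle. The trivial group (`k = 0`) is separate. -/
theorem card_sub_one_le_generatorIndex {Γ : Type*} [CommGroup Γ] [IsCyclic Γ] {p k : ℕ}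
    (hp : p.Prime) (hcard : Nat.card Γ = p ^ k) :
    Nat.card Γ - 1 ≤ generatorIndex (toPermHom Γ Γ).range := by
  have : Finite Γ := Nat.finite_of_card_ne_zero (by rw [hcard]; exact pow_ne_zero _ hp.ne_zero)
  rcases k with _ | k
  · simp [hcard]
  obtain ⟨S, hS, hS'⟩ := exists_finset_closure_eq_sup_eq_generatorIndex (toPermHom Γ Γ).range
  have himg : toPermHom Γ Γ '' (toPermHom Γ Γ ⁻¹' S) = S :=
    Set.image_preimage_eq_of_subset fun σ hσ => by
      have : σ ∈ (toPermHom Γ Γ).range := hS ▸ Subgroup.subset_closure hσ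
      exact this
  have hcl : Subgroup.closure (toPermHom Γ Γ ⁻¹' S) = ⊤ := by
    apply Subgroup.map_injective (f := toPermHom Γ Γ) toPerm_injective
    rw [MonoidHom.map_closure, himg, hS, MonoidHom.range_eq_map]
  obtain ⟨s, hs, hs'⟩ := exists_mem_zpowers_eq_top hp hcard hcl
  rw [← hS']
  exact (card_sub_one_le_permIndex_toPermHom hs').trans
    (Finset.le_sup (f := permIndex) (by exact hs))

end Regular

/-! ### Cyclic fields of prime conductor -/

section Cyclotomic

/-- The field is fixed by the subgroup generated by the `n`-th power of a generator; the
discriminant formula in the tower gives the divisibility. -/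
theorem exists_cyclic_subfield {L : Type*} [Field L] [NumberField L] [IsGalois ℚ L]
    [IsCyclic Gal(L/ℚ)] {n : ℕ} (hn : n ∣ finrank ℚ L) :
    ∃ F : IntermediateField ℚ L, IsGalois ℚ F ∧ IsCyclic Gal(F/ℚ) ∧
      Nat.card Gal(F/ℚ) = n ∧ (discr F).natAbs ^ (finrank ℚ L / n) ∣ (discr L).natAbs := by
  have hcard : Nat.card Gal(L/ℚ) = finrank ℚ L := IsGalois.card_aut_eq_finrank ℚ L
  let _ : CommGroup Gal(L/ℚ) := IsCyclic.commGroup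
  obtain ⟨g, hg⟩ := IsCyclic.exists_generator (α := Gal(L/ℚ))
  have hgord : orderOf g = finrank ℚ L := (orderOf_eq_card_of_forall_mem_zpowers hg).trans hcard
  have hpos : 0 < finrank ℚ L := finrank_pos
  have hn0 : n ≠ 0 := by
    rintro rfl
    exact hpos.ne' (zero_dvd_iff.1 hn)
  let H : Subgroup Gal(L/ℚ) := Subgroup.zpowers (g ^ n)
  have hH : Nat.card H = finrank ℚ L / n := by
    rw [Nat.card_zpowers, orderOf_pow, hgord, Nat.gcd_eq_right hn]
  let F : IntermediateField ℚ L := fixedField H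
  have hFL : finrank F L = finrank ℚ L / n := by
    rw [finrank_fixedField_eq_card, hH]
  have : H.Normal := inferInstance
  have hgal : IsGalois ℚ F := IsGalois.of_fixedField_normal_subgroup H
  let π : Gal(L/ℚ) →* Gal(F/ℚ) := AlgEquiv.restrictNormalHom F
  have hπ : Function.Surjective π := AlgEquiv.restrictNormalHom_surjective L
  refine ⟨F, hgal, isCyclic_of_surjective π hπ, ?_, ?_⟩
  · have h := finrank_mul_finrank ℚ F L
    rw [hFL] at h
    have h' : finrank ℚ F = n := by
      refine Nat.eq_of_mul_eq_mul_right (Nat.div_pos (Nat.le_of_dvd hpos hn)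
        (Nat.pos_of_ne_zero hn0)) ?_
      rw [Nat.mul_div_cancel' hn]
      exact h
    exact (IsGalois.card_aut_eq_finrank ℚ F).trans h'
  · rw [natAbs_discr_eq_absNorm_differentIdeal_mul_natAbs_discr_pow F (𝓞 F) L (𝓞 L), hFL]
    exact dvd_mul_left _ _

theorem isCyclotomicExtension_rat_cyclotomicField (ℓ : ℕ) [NeZero ℓ] :
    IsCyclotomicExtension {ℓ} ℚ (CyclotomicField ℓ ℚ) := by
  have h : ∀ (K : Type) [Field K] [NeZero (ℓ : K)],
      IsCyclotomicExtension {ℓ} K (CyclotomicField ℓ K) := fun _ _ _ => inferInstance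
  convert h ℚ
  · rfl
  · exact Subsingleton.elim _ _

/-- The subfield of degree `n` of the `ℓ`-th cyclotomic field. -/
theorem exists_cyclic_numberField {ℓ n : ℕ} [Fact ℓ.Prime] (hn : n ∣ ℓ - 1) :
    ∃ (F : Type) (_ : Field F) (_ : NumberField F), IsGalois ℚ F ∧ IsCyclic Gal(F/ℚ) ∧
      Nat.card Gal(F/ℚ) = n ∧ (discr F).natAbs ^ ((ℓ - 1) / n) ∣ ℓ ^ (ℓ - 2) := by
  let L := CyclotomicField ℓ ℚ
  have : IsCyclotomicExtension {ℓ} ℚ L := isCyclotomicExtension_rat_cyclotomicField ℓ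
  have : NumberField L := IsCyclotomicExtension.numberField {ℓ} ℚ L
  have : IsGalois ℚ L := IsCyclotomicExtension.isGalois {ℓ} ℚ L
  let θ : Gal(L/ℚ) ≃* (ZMod ℓ)ˣ := IsCyclotomicExtension.Rat.galEquivZMod ℓ L
  have : IsCyclic Gal(L/ℚ) := isCyclic_of_surjective θ.symm θ.symm.surjective
  have hrank : finrank ℚ L = ℓ - 1 := by
    rw [IsCyclotomicExtension.Rat.finrank ℓ L, Nat.totient_prime Fact.out]
  have hdiscr : (discr L).natAbs = ℓ ^ (ℓ - 2) := by
    rw [IsCyclotomicExtension.Rat.discr_prime ℓ L]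
    simp [Int.natAbs_mul, Int.natAbs_pow]
  obtain ⟨F, h₁, h₂, h₃, h₄⟩ := exists_cyclic_subfield (L := L) (hrank ▸ hn)
  rw [hrank, hdiscr] at h₄
  exact ⟨F, inferInstance, inferInstance, h₁, h₂, h₃, h₄⟩

theorem strongQuestion_range_toPermHom_of_isCyclic {Γ : Type*} [CommGroup Γ] [IsCyclic Γ] {p k : ℕ}
    (hp : p.Prime) (hcard : Nat.card Γ = p ^ k) : StrongQuestion (toPermHom Γ Γ).range := by
  intro N hN
  have hn : Nat.card Γ ≠ 0 := by rw [hcard]; exact pow_ne_zero _ hp.ne_zero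
  obtain ⟨ℓ, hℓ, hNℓ, hmod⟩ := Nat.exists_prime_gt_modEq_one N hn
  have : Fact ℓ.Prime := ⟨hℓ⟩
  have hdvd : Nat.card Γ ∣ ℓ - 1 := (Nat.modEq_iff_dvd' hℓ.one_lt.le).1 hmod.symm
  obtain ⟨F, _, _, _, _, hF, hd⟩ := exists_cyclic_numberField hdvd
  have hpos : 0 < (ℓ - 1) / Nat.card Γ :=
    Nat.div_pos (Nat.le_of_dvd (Nat.sub_pos_of_lt hℓ.one_lt) hdvd) (Nat.pos_of_ne_zero hn)
  have hprime : ∀ q : ℕ, q.Prime → q ∣ (discr F).natAbs → q = ℓ := fun q hq hqd =>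
    (Nat.prime_dvd_prime_iff_eq hq hℓ).1
      (hq.dvd_of_dvd_pow ((dvd_pow hqd hpos.ne').trans hd))
  refine ⟨F, inferInstance, inferInstance,
    isGExtension_range_toPermHom (mulEquivOfCyclicCardEq hF.symm), fun q hq hqd => ?_, ?_⟩
  · have hqd' : q ^ Nat.card Γ ∣ (discr F).natAbs := by
      refine (pow_dvd_pow q ?_).trans (Int.natCast_dvd.1 (by exact_mod_cast hqd))
      have := card_sub_one_le_generatorIndex hp hcard
      omega
    obtain rfl := hprime q hq ((dvd_pow_self q hn).trans hqd')
    have := (pow_dvd_pow_of_dvd hqd' _).trans hd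
    -- Here `q = ℓ`, and the divisibility would say `ℓ - 1 ≤ ℓ - 2`.
    rw [← pow_mul, Nat.mul_div_cancel' hdvd, Nat.pow_dvd_pow_iff_le_right hq.one_lt] at this
    have := hq.two_le
    omega
  · rw [Int.isCoprime_iff_gcd_eq_one]
    refine Nat.coprime_of_dvd fun q hq h₁ h₂ => ?_
    obtain rfl := hprime q hq h₁
    exact absurd (Nat.le_of_dvd hN h₂) (not_le.2 hNℓ)

end Cyclotomic

/-! ### Finite abelian groups -/

section Abelian

theorem StrongQuestion.range_toPermHom_congr {Γ Γ' : Type*} [Group Γ] [Group Γ'] [Finite Γ]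
    (f : Γ ≃* Γ') (h : StrongQuestion (toPermHom Γ Γ).range) :
    StrongQuestion (toPermHom Γ' Γ').range := by
  rw [← map_permCongr_range_toPermHom f]
  exact h.map_permCongr f.toEquiv

theorem strongQuestion_range_toPermHom_pi (ι : Type) [Finite ι] :
    ∀ (p : ι → ℕ) (_ : ∀ i, (p i).Prime) (e : ι → ℕ),
      StrongQuestion (toPermHom (∀ i, Multiplicative (ZMod (p i ^ e i)))
        (∀ i, Multiplicative (ZMod (p i ^ e i)))).range := by
  have hfin : ∀ (κ : Type) [Finite κ] (p : κ → ℕ) (_ : ∀ i, (p i).Prime) (e : κ → ℕ),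
      Finite (∀ i, Multiplicative (ZMod (p i ^ e i))) := by
    intro κ _ p hp e
    have : ∀ i, NeZero (p i ^ e i) := fun i => ⟨pow_ne_zero _ (hp i).ne_zero⟩
    have : ∀ i, Finite (Multiplicative (ZMod (p i ^ e i))) := fun i =>
      inferInstanceAs (Finite (ZMod (p i ^ e i)))
    infer_instance
  -- Induction on the index set, with the primes and exponents quantified inside so that they can be
  -- reindexed along bijections.
  refine Finite.induction_empty_option (P := fun ι => Finite ι → ∀ (p : ι → ℕ)
    (_ : ∀ i, (p i).Prime) (e : ι → ℕ), StrongQuestion (toPermHom (∀ i, Multiplicative (ZMod (p i ^ e i)))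
        (∀ i, Multiplicative (ZMod (p i ^ e i)))).range) ?_ ?_ ?_ ι ‹_›
  · intro ι κ f h _ p hp e
    have hι := Finite.of_equiv _ f.symm
    have := hfin _ (fun i => p (f i)) (fun i => hp (f i)) (fun i => e (f i))
    exact (h hι (fun i => p (f i)) (fun i => hp (f i)) (fun i => e (f i))).range_toPermHom_congr
      (MulEquiv.mk' (Equiv.piCongrLeft (fun j => Multiplicative (ZMod (p j ^ e j))) f).symm
        fun _ _ => rfl).symm
  · intro _ p hp e
    -- The empty product is trivial, of order `2 ^ 0`; the prime is arbitrary.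
    exact strongQuestion_range_toPermHom_of_isCyclic (k := 0) Nat.prime_two (by simp)
  · intro κ _ h _ p hp e
    have := hfin _ (fun i : κ => p i) (fun i => hp i) (fun i => e i)
    have : NeZero (p none ^ e none) := ⟨pow_ne_zero _ (hp none).ne_zero⟩
    have : Finite (Multiplicative (ZMod (p none ^ e none))) :=
      inferInstanceAs (Finite (ZMod (p none ^ e none)))
    have h₁ : StrongQuestion (toPermHom (Multiplicative (ZMod (p none ^ e none))) _).range :=
      strongQuestion_range_toPermHom_of_isCyclic (hp none) (Nat.card_zmod _)
    have h₂ := h₁.productAction (h inferInstance (fun i => p i) (fun i => hp i) (fun i => e i))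
    rw [← range_toPermHom_prod] at h₂
    exact h₂.range_toPermHom_congr (MulEquiv.mk' (Equiv.piOptionEquivProd
      (β := fun j : Option κ => Multiplicative (ZMod (p j ^ e j)))) fun _ _ => rfl).symm

theorem strongQuestion_range_toPermHom (Γ : Type*) [CommGroup Γ] [Finite Γ] :
    StrongQuestion (toPermHom Γ Γ).range := by
  obtain ⟨ι, _, p, hp, e, ⟨f⟩⟩ := AddCommGroup.equiv_directSum_zmod_of_finite (Additive Γ)
  classical
  have g : Γ ≃* ∀ i, Multiplicative (ZMod (p i ^ e i)) :=
    MulEquiv.toAdditive.symm (f.trans ((DirectSum.addEquivProd _).trans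
      (MulEquiv.piMultiplicative _).toAdditiveRight))
  have := Finite.of_equiv _ g.toEquiv
  exact (strongQuestion_range_toPermHom_pi ι p hp e).range_toPermHom_congr g.symm

theorem strongQuestion_of_comm {α : Type*} [Finite α] [Nonempty α] (A : Subgroup (Equiv.Perm α))
    (hA : IsPretransitive A α) (hcomm : ∀ x ∈ A, ∀ y ∈ A, x * y = y * x) : StrongQuestion A := by
  let _ : CommGroup A := { mul_comm := fun x y => Subtype.ext (hcomm x x.2 y y.2) }
  obtain ⟨e, he⟩ := exists_equiv_map_range_toPermHom_eq A hA hcomm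
  have h := (strongQuestion_range_toPermHom A).map_permCongr e
  rw [← he]
  exact h

end Abelian

end

theorem lemma2p2 :
    (∀ {α β : Type*} [Finite α] [Nonempty α] [Finite β] [Nonempty β]
      (G : Subgroup (Equiv.Perm α)) (H : Subgroup (Equiv.Perm β)),
      MulAction.IsPretransitive G α → MulAction.IsPretransitive H β →
        MulAction.IsPretransitive (productAction G H) (α × β) ∧
        generatorIndex (productAction G H) =
          max (Nat.card β * generatorIndex G) (Nat.card α * generatorIndex H) ∧
        (StrongQuestion G → StrongQuestion H → StrongQuestion (productAction G H))) ∧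
    (∀ {α : Type*} [Finite α] [Nonempty α] (A : Subgroup (Equiv.Perm α)),
      MulAction.IsPretransitive A α → (∀ x ∈ A, ∀ y ∈ A, x * y = y * x) →
        StrongQuestion A) := by
  refine ⟨fun G H hG hH => ⟨isPretransitive_productAction hG hH, generatorIndex_productAction G H,
    fun h h' => h.productAction h'⟩, fun A hA hcomm => strongQuestion_of_comm A hA hcomm⟩
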